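/- Let $m,n\in\mathbb{N}$, let $\mathbb{P}_m$ be the set of all $m\times m$ complex Hermitian positive definite matrices, and for $A,B\in\mathbb{P}_m$ let $$d(A,B)=\Bigl[\operatorname{tr}\Bigl(\frac{A+B}{2}\Bigr)-\operatorname{tr}\,(A^{1/2}BA^{1/2})^{1/2}\Bigr]^{1/2}$$ be the Bures-Wasserstein distance. Let $\mathbb{A}=(A_1,\dots,A_n)\in\mathbb{P}_m^n$ and let $\omega=(w_1,\dots,w_n)$ be a positive probability vector, that is, $w_j>0$ for all $j$ and $\sum_{j=1}^n w_j=1$. Then the function $X\mapsto\sum_{j=1}^n w_j\,d^2(X,A_j)$ on $\mathbb{P}_m$ has a unique minimizer $\Omega(\omega;\mathbb{A})\in\mathbb{P}_m$, called the Wasserstein mean of $\mathbb{A}$ with weights $\omega$, and $$\det\Omega(\omega;\mathbb{A})\;\ge\;\prod_{j=1}^n(\det A_j)^{w_j},$$ where equality holds if and only if $A_1=\dots=A_n$. -/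

import Mathlib

open scoped ComplexOrder MatrixOrder

noncomputable section

namespace WassersteinMean

variable {m n : ℕ}

/-- The positive semidefinite square root `A^{1/2}` of a positive semidefinite matrix `A`. -/
abbrev msqrt (A : Matrix (Fin m) (Fin m) ℂ) : Matrix (Fin m) (Fin m) ℂ :=
  CFC.sqrt A

/-- The Bures-Wasserstein distance
`d(A, B) = [tr ((A + B) / 2) - tr (A^{1/2} B A^{1/2})^{1/2}]^{1/2}` of two positive definite
matrices. Both traces are real numbers, so that taking real parts loses nothing. -/
def wassersteinDist (A B : Matrix (Fin m) (Fin m) ℂ) : ℝ :=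
  Real.sqrt ((((1 / 2 : ℂ) • (A + B)).trace).re - ((msqrt (msqrt A * B * msqrt A)).trace).re)

/-- The weighted sum of squared distances `X ↦ ∑ j, w j * d(X, A j) ^ 2`. -/
def objective (w : Fin n → ℝ) (A : Fin n → Matrix (Fin m) (Fin m) ℂ)
    (X : Matrix (Fin m) (Fin m) ℂ) : ℝ :=
  ∑ j, w j * wassersteinDist X (A j) ^ 2

/-- `X` is a positive definite matrix that minimizes the objective function among all
positive definite matrices. -/
def IsMinimizer (w : Fin n → ℝ) (A : Fin n → Matrix (Fin m) (Fin m) ℂ)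
    (X : Matrix (Fin m) (Fin m) ℂ) : Prop :=
  X.PosDef ∧ IsMinOn (objective w A) {Y | Y.PosDef} X

/-- The Wasserstein mean `Ω(w; A)`: the minimizer of the objective function over the cone of
positive definite matrices. -/
def mean (w : Fin n → ℝ) (A : Fin n → Matrix (Fin m) (Fin m) ℂ) : Matrix (Fin m) (Fin m) ℂ :=
  Classical.epsilon (IsMinimizer w A)

end WassersteinMean

end

/-! Given positive definite `X` and `A`, let `T` be the positive definite solution of `T * X * T =
A`, the optimal transport; the fidelity is then tr(TX). Expanding weighted squares tr(M Y Mᴴ N) ≥ 0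
gives 2 F(Y, A) ≤ tr(YT) + tr(AT⁻¹) for every positive definite T, with equality only if TYT = A.
With T_j the transports from X to A_j and S = ∑ w_j T_j, the objective therefore has at X an affine
minorant of slope (1 - S)/2, and X is the unique minimizer once S = 1.

Such an X exists because X ↦ SXS maps the whole cone into a compact set and lowers the objective by
at least tr((S - 1)X(S - 1))/2: a minimizer over the compact set must have S = 1
(`exists_balanced_transport`).

Finally ∏ (det A_j)^{w_j} = (∏ (det T_j)^{w_j})² det X, and averaging log det T_j ≤ tr T_j - m under
S = 1 bounds the product over T_j by 1, with equality only if every T_j = 1. -/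

namespace WassersteinMean

open Matrix

variable {m n : ℕ}

/-! ### Congruences and weighted traces -/

section Positivity

variable {X Y N P G : Matrix (Fin m) (Fin m) ℂ}

lemma posDef_congr (hP : P.PosDef) (hG : G.PosDef) : (P * G * P).PosDef := by
  have h := (Matrix.IsUnit.posDef_star_left_conjugate_iff (x := G) hP.isUnit).2 hG
  rwa [star_eq_conjTranspose, hP.isHermitian.eq] at h

lemma posDef_msqrt (hX : X.PosDef) : (msqrt X).PosDef :=
  hX.isStrictlyPositive.sqrt.posDef

lemma msqrt_mul_self (hX : X.PosDef) : msqrt X * msqrt X = X :=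
  CFC.sqrt_mul_sqrt_self X hX.posSemidef.nonneg

lemma inv_mul_self (hX : X.PosDef) : X⁻¹ * X = 1 :=
  nonsing_inv_mul X (X.isUnit_iff_isUnit_det.1 hX.isUnit)

lemma mul_inv_self (hX : X.PosDef) : X * X⁻¹ = 1 :=
  mul_nonsing_inv X (X.isUnit_iff_isUnit_det.1 hX.isUnit)

lemma det_im_eq_zero (hX : X.PosDef) : X.det.im = 0 :=
  (Complex.pos_iff.1 hX.det_pos).2.symm

lemma det_re_pos (hX : X.PosDef) : 0 < X.det.re :=
  (Complex.pos_iff.1 hX.det_pos).1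

lemma det_re_congr (hP : P.PosDef) (hG : G.PosDef) :
    (P * G * P).det.re = P.det.re ^ 2 * G.det.re := by
  simp only [det_mul, Complex.mul_re, Complex.mul_im, det_im_eq_zero hP, det_im_eq_zero hG]
  ring

/-- The weighted trace is a squared Frobenius norm, whence both its sign and its definiteness. -/
lemma trace_weighted_eq (hY : Y.PosDef) (hN : N.PosDef) (M : Matrix (Fin m) (Fin m) ℂ) :
    (M * Y * Mᴴ * N).trace = ((msqrt Y * Mᴴ * msqrt N)ᴴ * (msqrt Y * Mᴴ * msqrt N)).trace := by
  have h1 := msqrt_mul_self hY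
  have h2 := msqrt_mul_self hN
  have h3 := (posDef_msqrt hY).isHermitian.eq
  have h4 := (posDef_msqrt hN).isHermitian.eq
  generalize msqrt Y = Q at *
  generalize msqrt N = R at *
  subst h1 h2
  simp only [conjTranspose_mul, conjTranspose_conjTranspose, h3, h4]
  rw [show R * (M * Q) * (Q * Mᴴ * R) = R * (M * (Q * Q) * Mᴴ * R) by noncomm_ring,
    trace_mul_comm R]
  congr 1
  noncomm_ring

lemma trace_weighted_nonneg (hY : Y.PosDef) (hN : N.PosDef) (M : Matrix (Fin m) (Fin m) ℂ) :
    0 ≤ (M * Y * Mᴴ * N).trace.re := by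
  rw [trace_weighted_eq hY hN]
  exact (Complex.nonneg_iff.1 (posSemidef_conjTranspose_mul_self _).trace_nonneg).1

lemma eq_zero_of_trace_weighted (hY : Y.PosDef) (hN : N.PosDef)
    {M : Matrix (Fin m) (Fin m) ℂ} (h : (M * Y * Mᴴ * N).trace.re ≤ 0) : M = 0 := by
  have h0 : (M * Y * Mᴴ * N).trace = 0 := by
    refine Complex.ext (le_antisymm h (trace_weighted_nonneg hY hN M)) ?_
    rw [trace_weighted_eq hY hN]
    exact (Complex.nonneg_iff.1 (posSemidef_conjTranspose_mul_self _).trace_nonneg).2.symm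
  rw [trace_weighted_eq hY hN, trace_conjTranspose_mul_self_eq_zero_iff] at h0
  have h1 := (posDef_msqrt hY).isUnit
  have h2 := (posDef_msqrt hN).isUnit
  rw [h2.mul_left_eq_zero, h1.mul_right_eq_zero] at h0
  simpa using h0

end Positivity

/-! ### Optimal transports and the variational bound for the fidelity -/

section Fidelity

variable {X Y A S T R : Matrix (Fin m) (Fin m) ℂ}

/-- The fidelity `tr (X^{1/2} A X^{1/2})^{1/2}`. -/
noncomputable def fidelity (X A : Matrix (Fin m) (Fin m) ℂ) : ℝ :=
  (msqrt (msqrt X * A * msqrt X)).trace.re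

lemma fidelity_transport (hX : X.PosDef) (hT : T.PosDef) :
    fidelity X (T * X * T) = (T * X).trace.re := by
  have h1 := msqrt_mul_self hX
  have hP := posDef_msqrt hX
  unfold fidelity
  generalize msqrt X = P at *
  subst h1
  have h : msqrt (P * (T * (P * P) * T) * P) = P * T * P :=
    CFC.sqrt_unique (by noncomm_ring) (posDef_congr hP hT).posSemidef.nonneg
  rw [h, ← trace_mul_comm P, ← mul_assoc, trace_mul_comm]

lemma exists_transport (hX : X.PosDef) (hA : A.PosDef) :
    ∃ T : Matrix (Fin m) (Fin m) ℂ, T.PosDef ∧ T * X * T = A := by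
  have h1 := msqrt_mul_self hX
  have hP := posDef_msqrt hX
  have h2 := posDef_congr hP hA
  have h3 := msqrt_mul_self h2
  -- The witness is X^{-1/2} (X^{1/2} A X^{1/2})^{1/2} X^{-1/2}.
  refine ⟨_, posDef_congr hP.inv (posDef_msqrt h2), ?_⟩
  generalize msqrt (msqrt X * A * msqrt X) = G at *
  generalize msqrt X = P at *
  subst h1
  calc P⁻¹ * G * P⁻¹ * (P * P) * (P⁻¹ * G * P⁻¹)
      = P⁻¹ * G * (P⁻¹ * P) * (P * P⁻¹) * G * P⁻¹ := by noncomm_ring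
    _ = P⁻¹ * (G * G) * P⁻¹ := by
      rw [inv_mul_self hP, mul_inv_self hP]; noncomm_ring
    _ = (P⁻¹ * P) * A * (P * P⁻¹) := by rw [h3]; noncomm_ring
    _ = A := by rw [inv_mul_self hP, mul_inv_self hP]; noncomm_ring

/-- If S transports Y to A = SYS, the right side is the gap tr(YT) + tr(AT⁻¹) - 2 F(Y, A), here
exhibited as a weighted square that vanishes only at T = S. -/
lemma trace_transport_gap (hT : T.PosDef) (hS : S.PosDef) :
    ((T - S) * Y * (T - S)ᴴ * T⁻¹).trace.re =
      (Y * T).trace.re + (S * Y * S * T⁻¹).trace.re - 2 * (S * Y).trace.re := by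
  have h : (T - S) * Y * (T - S)ᴴ * T⁻¹ =
      T * Y * (T * T⁻¹) - S * Y * (T * T⁻¹) - T * Y * S * T⁻¹ + S * Y * S * T⁻¹ := by
    rw [conjTranspose_sub, hT.isHermitian.eq, hS.isHermitian.eq]; noncomm_ring
  rw [h, mul_inv_self hT]
  simp only [mul_one, trace_add, trace_sub, Complex.add_re, Complex.sub_re]
  rw [trace_mul_comm (T * Y * S), ← mul_assoc, ← mul_assoc, inv_mul_self hT, one_mul,
    trace_mul_comm T Y, trace_mul_comm Y S]
  ring

lemma two_mul_fidelity_le (hY : Y.PosDef) (hA : A.PosDef) (hT : T.PosDef) :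
    2 * fidelity Y A ≤ (Y * T).trace.re + (A * T⁻¹).trace.re := by
  obtain ⟨S, hS, rfl⟩ := exists_transport hY hA
  have h := trace_weighted_nonneg hY hT.inv (T - S)
  rw [trace_transport_gap hT hS] at h
  rw [fidelity_transport hY hS]
  linarith

lemma transport_eq_of_le_two_mul_fidelity (hY : Y.PosDef) (hA : A.PosDef) (hT : T.PosDef)
    (h : (Y * T).trace.re + (A * T⁻¹).trace.re ≤ 2 * fidelity Y A) : T * Y * T = A := by
  obtain ⟨S, hS, rfl⟩ := exists_transport hY hA
  rw [fidelity_transport hY hS] at h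
  have h0 := eq_zero_of_trace_weighted hY hT.inv (M := T - S)
    (by rw [trace_transport_gap hT hS]; linarith)
  rw [sub_eq_zero.1 h0]

lemma transport_unique (hX : X.PosDef) (hS : S.PosDef) (hT : T.PosDef)
    (h : S * X * S = T * X * T) : S = T := by
  refine (sub_eq_zero.1 (eq_zero_of_trace_weighted hX hT.inv (M := T - S) ?_)).symm
  have hf := fidelity_transport hX hS
  rw [h, fidelity_transport hX hT] at hf
  rw [trace_transport_gap hT hS, h, mul_assoc (T * X), mul_inv_self hT, mul_one,
    trace_mul_comm X T]
  linarith

lemma two_mul_fidelity_transport_le (hX : X.PosDef) (hY : Y.PosDef) (hT : T.PosDef) :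
    2 * fidelity Y (T * X * T) ≤ (Y * T).trace.re + (X * T).trace.re := by
  have h := two_mul_fidelity_le hY (posDef_congr hT hX) hT
  rwa [mul_assoc (T * X), mul_inv_self hT, mul_one, trace_mul_comm T] at h

lemma eq_of_le_two_mul_fidelity_transport (hX : X.PosDef) (hY : Y.PosDef) (hT : T.PosDef)
    (h : (Y * T).trace.re + (X * T).trace.re ≤ 2 * fidelity Y (T * X * T)) : Y = X := by
  have h1 := transport_eq_of_le_two_mul_fidelity hY (posDef_congr hT hX) hT (by
    rwa [mul_assoc (T * X), mul_inv_self hT, mul_one, trace_mul_comm T])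
  rwa [hT.isUnit.mul_left_inj, hT.isUnit.mul_right_inj] at h1

/-- If R transports SXS to TXT, the square of RS - T with weights X and R⁻¹ expands to 2 F(SXS, TXT)
- 2 tr(SXT). -/
lemma trace_le_fidelity (hX : X.PosDef) (hS : S.PosDef) (hT : T.PosDef) :
    (S * X * T).trace.re ≤ fidelity (S * X * S) (T * X * T) := by
  obtain ⟨R, hR, hRT⟩ := exists_transport (posDef_congr hS hX) (posDef_congr hT hX)
  rw [← hRT, fidelity_transport (posDef_congr hS hX) hR]
  have h := trace_weighted_nonneg hX hR.inv (R * S - T)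
  have e : (R * S - T) * X * (R * S - T)ᴴ * R⁻¹ =
      R * (S * X * S) * (R * R⁻¹) - R * (S * X * T * R⁻¹) - T * X * S * (R * R⁻¹)
        + T * X * T * R⁻¹ := by
    rw [conjTranspose_sub, conjTranspose_mul, hR.isHermitian.eq, hS.isHermitian.eq,
      hT.isHermitian.eq]
    noncomm_ring
  have e1 : (T * X * S).trace.re = (S * X * T).trace.re := by
    have : (T * X * S) = (S * X * T)ᴴ := by
      simp [conjTranspose_mul, hX.isHermitian.eq, hS.isHermitian.eq, hT.isHermitian.eq, mul_assoc]
    rw [this, trace_conjTranspose]; simp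
  rw [e, ← hRT, mul_assoc _ R R⁻¹, mul_inv_self hR] at h
  simp only [mul_one, trace_add, trace_sub, Complex.add_re, Complex.sub_re, e1] at h
  rw [trace_mul_comm R (S * X * T * R⁻¹), mul_assoc (S * X * T), inv_mul_self hR, mul_one] at h
  linarith

lemma wassersteinDist_sq (hX : X.PosDef) (hA : A.PosDef) :
    wassersteinDist X A ^ 2 = (X.trace.re + A.trace.re) / 2 - fidelity X A := by
  -- Testing with T = 1 shows that the radicand is nonnegative, so `Real.sqrt` does not truncate.
  have h := two_mul_fidelity_le hX hA PosDef.one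
  have e : (((1 / 2 : ℂ) • (X + A)).trace).re = (X.trace.re + A.trace.re) / 2 := by
    rw [trace_smul, trace_add, smul_eq_mul, show (1 / 2 : ℂ) = ((1 / 2 : ℝ) : ℂ) by simp,
      Complex.re_ofReal_mul, Complex.add_re]
    ring
  rw [inv_one, mul_one, mul_one] at h
  rw [wassersteinDist, Real.sq_sqrt, e, fidelity]
  rw [e]
  change 0 ≤ _ - fidelity X A
  linarith

end Fidelity

/-! ### The bound log det M ≤ tr M - m, from log x ≤ x - 1 on eigenvalues -/

section Determinant

variable {M : Matrix (Fin m) (Fin m) ℂ}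

lemma log_det_le (hM : M.PosDef) : Real.log M.det.re ≤ M.trace.re - m := by
  have h1 : M.det.re = ∏ i, hM.isHermitian.eigenvalues i := by
    rw [hM.isHermitian.det_eq_prod_eigenvalues]; norm_cast
  have h2 : M.trace.re = ∑ i, hM.isHermitian.eigenvalues i := by
    rw [hM.isHermitian.trace_eq_sum_eigenvalues]; norm_cast
  rw [h1, h2, Real.log_prod fun i _ => (hM.eigenvalues_pos i).ne']
  calc _ ≤ ∑ i, (hM.isHermitian.eigenvalues i - 1) :=
        Finset.sum_le_sum fun i _ => Real.log_le_sub_one_of_pos (hM.eigenvalues_pos i)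
    _ = _ := by simp

lemma eq_one_of_le_log_det (hM : M.PosDef) (h : M.trace.re - m ≤ Real.log M.det.re) : M = 1 := by
  have h1 : M.det.re = ∏ i, hM.isHermitian.eigenvalues i := by
    rw [hM.isHermitian.det_eq_prod_eigenvalues]; norm_cast
  have h2 : M.trace.re = ∑ i, hM.isHermitian.eigenvalues i := by
    rw [hM.isHermitian.trace_eq_sum_eigenvalues]; norm_cast
  rw [h1, h2, Real.log_prod fun i _ => (hM.eigenvalues_pos i).ne'] at h
  have h3 : ∀ i, hM.isHermitian.eigenvalues i = 1 := by
    by_contra! hne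
    obtain ⟨i, hi⟩ := hne
    have : ∑ i, Real.log (hM.isHermitian.eigenvalues i) <
        ∑ i, (hM.isHermitian.eigenvalues i - 1) :=
      Finset.sum_lt_sum (fun i _ => Real.log_le_sub_one_of_pos (hM.eigenvalues_pos i))
        ⟨i, Finset.mem_univ i, Real.log_lt_sub_one_of_pos (hM.eigenvalues_pos i) hi⟩
    simp at this
    linarith
  rw [hM.isHermitian.spectral_theorem]
  have : (diagonal (RCLike.ofReal ∘ hM.isHermitian.eigenvalues) : Matrix (Fin m) (Fin m) ℂ) = 1 := by
    ext i j
    simp [diagonal_apply, one_apply, h3]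
  rw [this, map_one]

end Determinant

/-! ### Determinants of weighted averages -/

section WeightedSums

variable {w : Fin n → ℝ} {T : Fin n → Matrix (Fin m) (Fin m) ℂ}

lemma trace_weightedSum_re (w : Fin n → ℝ) (T : Fin n → Matrix (Fin m) (Fin m) ℂ) :
    (∑ j, w j • T j).trace.re = ∑ j, w j * (T j).trace.re := by
  simp [trace_sum, trace_smul, Complex.re_sum]

lemma posDef_weightedSum (hw : ∀ j, 0 < w j) (hw1 : ∑ j, w j = 1) (hT : ∀ j, (T j).PosDef) :
    (∑ j, w j • T j).PosDef := by
  have : Nonempty (Fin n) := by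
    by_contra h
    rw [not_nonempty_iff] at h
    simp at hw1
  exact posDef_sum Finset.univ_nonempty fun j _ => (hT j).smul (hw j)

lemma log_prod_det (hT : ∀ j, (T j).PosDef) :
    Real.log (∏ j, (T j).det.re ^ w j) = ∑ j, w j * Real.log (T j).det.re := by
  rw [Real.log_prod fun j _ => (Real.rpow_pos_of_pos (det_re_pos (hT j)) _).ne']
  exact Finset.sum_congr rfl fun j _ => Real.log_rpow (det_re_pos (hT j)) _

lemma sum_trace_sub_dim (hw1 : ∑ j, w j = 1) (h : ∑ j, w j • T j = 1) :
    ∑ j, w j * ((T j).trace.re - m) = 0 := by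
  have := trace_weightedSum_re w T
  rw [h] at this
  simp only [mul_sub, Finset.sum_sub_distrib, ← this, ← Finset.sum_mul, hw1]
  simp

lemma prod_det_le_one (hw : ∀ j, 0 < w j) (hw1 : ∑ j, w j = 1) (hT : ∀ j, (T j).PosDef)
    (h : ∑ j, w j • T j = 1) : ∏ j, (T j).det.re ^ w j ≤ 1 := by
  rw [← Real.log_nonpos_iff (Finset.prod_nonneg fun j _ =>
    (Real.rpow_pos_of_pos (det_re_pos (hT j)) _).le), log_prod_det hT, ← sum_trace_sub_dim hw1 h]
  exact Finset.sum_le_sum fun j _ => mul_le_mul_of_nonneg_left (log_det_le (hT j)) (hw j).le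

lemma eq_one_of_prod_det_eq_one (hw : ∀ j, 0 < w j) (hw1 : ∑ j, w j = 1)
    (hT : ∀ j, (T j).PosDef) (h : ∑ j, w j • T j = 1) (hd : ∏ j, (T j).det.re ^ w j = 1) (j) :
    T j = 1 := by
  have h1 := log_prod_det (w := w) hT
  rw [hd, Real.log_one, ← sum_trace_sub_dim hw1 h, eq_comm, Finset.sum_eq_sum_iff_of_le
    fun j _ => mul_le_mul_of_nonneg_left (log_det_le (hT j)) (hw j).le] at h1
  exact eq_one_of_le_log_det (hT j)
    (mul_left_cancel₀ (hw j).ne' (h1 j (Finset.mem_univ j))).ge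

/-- A congruence by Q with QSQ = 1, S being the average, reduces this to `prod_det_le_one`; both
sides scale by (det Q)² because the weights sum to 1. -/
lemma prod_det_le_det_weightedSum (hw : ∀ j, 0 < w j) (hw1 : ∑ j, w j = 1)
    (hT : ∀ j, (T j).PosDef) : ∏ j, (T j).det.re ^ w j ≤ (∑ j, w j • T j).det.re := by
  have hS := posDef_weightedSum hw hw1 hT
  obtain ⟨Q, hQ, hQS⟩ := exists_transport hS PosDef.one
  have h1 := prod_det_le_one hw hw1 (fun j => posDef_congr hQ (hT j))
    (by rw [← hQS, Finset.mul_sum, Finset.sum_mul]; simp)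
  have h2 := det_re_congr hQ hS
  rw [hQS, det_one, Complex.one_re] at h2
  have hq := pow_pos (det_re_pos hQ) 2
  simp only [det_re_congr hQ (hT _), Real.mul_rpow hq.le (det_re_pos (hT _)).le,
    Finset.prod_mul_distrib, ← Real.rpow_sum_of_pos hq, hw1, Real.rpow_one] at h1
  exact le_of_mul_le_mul_left (h1.trans_eq h2) hq

lemma prod_det_congr {X : Matrix (Fin m) (Fin m) ℂ} (hX : X.PosDef) (hw1 : ∑ j, w j = 1)
    (hT : ∀ j, (T j).PosDef) :
    ∏ j, (T j * X * T j).det.re ^ w j = (∏ j, (T j).det.re ^ w j) ^ 2 * X.det.re := by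
  have e (j) : (T j * X * T j).det.re ^ w j = ((T j).det.re ^ w j) ^ 2 * X.det.re ^ w j := by
    rw [det_re_congr (hT j) hX, Real.mul_rpow (sq_nonneg _) (det_re_pos hX).le,
      Real.rpow_pow_comm (det_re_pos (hT j)).le]
  simp only [e, Finset.prod_mul_distrib, Finset.prod_pow, ← Real.rpow_sum_of_pos (det_re_pos hX),
    hw1, Real.rpow_one]

end WeightedSums

/-! ### Support, descent and semicontinuity of the objective -/

section Objective

variable {w : Fin n → ℝ} {A T : Fin n → Matrix (Fin m) (Fin m) ℂ} {X Y : Matrix (Fin m) (Fin m) ℂ}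

lemma objective_eq (hw1 : ∑ j, w j = 1) (hA : ∀ j, (A j).PosDef) (hX : X.PosDef) :
    objective w A X =
      X.trace.re / 2 + ∑ j, w j * (A j).trace.re / 2 - ∑ j, w j * fidelity X (A j) := by
  have h : X.trace.re / 2 = ∑ j, w j * (X.trace.re / 2) := by
    rw [← Finset.sum_mul, hw1, one_mul]
  rw [objective, h, ← Finset.sum_add_distrib, ← Finset.sum_sub_distrib]
  refine Finset.sum_congr rfl fun j _ => ?_
  rw [wassersteinDist_sq hX (hA j)]
  ring

lemma trace_mul_weightedSum_re (w : Fin n → ℝ) (T : Fin n → Matrix (Fin m) (Fin m) ℂ)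
    (X : Matrix (Fin m) (Fin m) ℂ) :
    (X * ∑ j, w j • T j).trace.re = ∑ j, w j * (X * T j).trace.re := by
  rw [Finset.mul_sum, ← trace_weightedSum_re]
  simp

lemma objective_transport (hw1 : ∑ j, w j = 1) (hX : X.PosDef) (hT : ∀ j, (T j).PosDef) :
    objective w (fun j => T j * X * T j) X = X.trace.re / 2
      + ∑ j, w j * (T j * X * T j).trace.re / 2 - (X * ∑ j, w j • T j).trace.re := by
  rw [objective_eq hw1 (fun j => posDef_congr (hT j) hX) hX, trace_mul_weightedSum_re]
  simp only [fidelity_transport hX (hT _), trace_mul_comm X]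

/-- The supporting affine minorant of the objective function at `X`. -/
lemma le_objective (hw : ∀ j, 0 < w j) (hw1 : ∑ j, w j = 1) (hX : X.PosDef)
    (hT : ∀ j, (T j).PosDef) (hY : Y.PosDef) :
    objective w (fun j => T j * X * T j) X + (Y.trace.re - X.trace.re) / 2
      - ((Y * ∑ j, w j • T j).trace.re - (X * ∑ j, w j • T j).trace.re) / 2
      ≤ objective w (fun j => T j * X * T j) Y := by
  have h : ∑ j, w j * (2 * fidelity Y (T j * X * T j)) ≤
      ∑ j, w j * ((Y * T j).trace.re + (X * T j).trace.re) :=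
    Finset.sum_le_sum fun j _ =>
      mul_le_mul_of_nonneg_left (two_mul_fidelity_transport_le hX hY (hT j)) (hw j).le
  simp only [mul_add, Finset.sum_add_distrib, ← trace_mul_weightedSum_re, mul_left_comm _ (2 : ℝ),
    ← Finset.mul_sum] at h
  rw [objective_transport hw1 hX hT, objective_eq hw1 (fun j => posDef_congr (hT j) hX) hY]
  linarith

/-- If the optimal transports from `X` average to the identity, then `X` is the only minimizer. -/
lemma eq_of_objective_le (hw : ∀ j, 0 < w j) (hw1 : ∑ j, w j = 1) (hX : X.PosDef)
    (hT : ∀ j, (T j).PosDef) (hS : ∑ j, w j • T j = 1) (hY : Y.PosDef)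
    (h : objective w (fun j => T j * X * T j) Y ≤ objective w (fun j => T j * X * T j) X) :
    Y = X := by
  have h1 (j) (_ : j ∈ Finset.univ) : w j * (2 * fidelity Y (T j * X * T j)) ≤
      w j * ((Y * T j).trace.re + (X * T j).trace.re) :=
    mul_le_mul_of_nonneg_left (two_mul_fidelity_transport_le hX hY (hT j)) (hw j).le
  have h2 : ∑ j, w j * (2 * fidelity Y (T j * X * T j)) =
      ∑ j, w j * ((Y * T j).trace.re + (X * T j).trace.re) := by
    refine le_antisymm (Finset.sum_le_sum h1) ?_
    simp only [mul_add, Finset.sum_add_distrib, ← trace_mul_weightedSum_re,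
      mul_left_comm _ (2 : ℝ), ← Finset.mul_sum]
    rw [objective_transport hw1 hX hT, objective_eq hw1 (fun j => posDef_congr (hT j) hX) hY] at h
    rw [hS, mul_one] at *
    rw [mul_one]
    linarith
  rw [Finset.sum_eq_sum_iff_of_le h1] at h2
  have : Nonempty (Fin n) := by
    by_contra hn
    rw [not_nonempty_iff] at hn
    simp at hw1
  -- Equality at a single index already forces Y = X.
  obtain ⟨j⟩ := this
  exact eq_of_le_two_mul_fidelity_transport hX hY (hT j)
    (mul_left_cancel₀ (hw j).ne' (h2 j (Finset.mem_univ j))).ge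

/-- The fixed point map `X ↦ S X S`, with `S` the average of the optimal transports from `X`,
decreases the objective function. -/
lemma objective_congr_le (hw : ∀ j, 0 < w j) (hw1 : ∑ j, w j = 1) (hX : X.PosDef)
    (hT : ∀ j, (T j).PosDef) {S : Matrix (Fin m) (Fin m) ℂ} (hS : S.PosDef)
    (hTS : ∑ j, w j • T j = S) :
    objective w (fun j => T j * X * T j) (S * X * S)
      + ((S - 1) * X * (S - 1)ᴴ * 1).trace.re / 2 ≤ objective w (fun j => T j * X * T j) X := by
  have h : (S * X * S).trace.re ≤ ∑ j, w j * fidelity (S * X * S) (T j * X * T j) := by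
    have e : (S * X * S).trace.re = (S * X * ∑ j, w j • T j).trace.re := by rw [hTS]
    rw [e, trace_mul_weightedSum_re]
    exact Finset.sum_le_sum fun j _ =>
      mul_le_mul_of_nonneg_left (trace_le_fidelity hX hS (hT j)) (hw j).le
  have e : (S - 1) * X * (S - 1)ᴴ * 1 = S * X * S - S * X - X * S + X := by
    rw [conjTranspose_sub, hS.isHermitian.eq, conjTranspose_one]; noncomm_ring
  rw [objective_transport hw1 hX hT, hTS,
    objective_eq hw1 (fun j => posDef_congr (hT j) hX) (posDef_congr hS hX), e]
  simp only [trace_add, trace_sub, Complex.add_re, Complex.sub_re, trace_mul_comm S X]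
  linarith

/-- Averaging 2 tr(SXT_j) ≤ tr(SXS) + tr(T_jXT_j) turns the left side into 2 tr(SXS). This bounds
the trace along the fixed point map. -/
lemma trace_congr_le (hw : ∀ j, 0 < w j) (hw1 : ∑ j, w j = 1) (hX : X.PosDef)
    (hT : ∀ j, (T j).PosDef) {S : Matrix (Fin m) (Fin m) ℂ} (hS : S.PosDef)
    (hTS : ∑ j, w j • T j = S) :
    (S * X * S).trace.re ≤ ∑ j, w j * (T j * X * T j).trace.re := by
  have h : ∑ j, w j * (2 * (S * X * T j).trace.re) ≤
      ∑ j, w j * ((S * X * S).trace.re + (T j * X * T j).trace.re) := by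
    refine Finset.sum_le_sum fun j _ => mul_le_mul_of_nonneg_left ?_ (hw j).le
    have h1 := trace_le_fidelity hX hS (hT j)
    have h2 := two_mul_fidelity_le (posDef_congr hS hX) (posDef_congr (hT j) hX) PosDef.one
    rw [inv_one, mul_one, mul_one] at h2
    linarith
  simp only [mul_add, Finset.sum_add_distrib, ← trace_mul_weightedSum_re, mul_left_comm _ (2 : ℝ),
    ← Finset.mul_sum, ← Finset.sum_mul, hw1, hTS] at h
  linarith

/-- The affine minorant at X is continuous and touches the objective there, so continuity of the
matrix square root is not needed. -/
lemma lowerSemicontinuousOn_objective (hw : ∀ j, 0 < w j) (hw1 : ∑ j, w j = 1)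
    (hA : ∀ j, (A j).PosDef) : LowerSemicontinuousOn (objective w A) {X | X.PosDef} := by
  intro X hX y hy
  choose T hT hTA using fun j => exists_transport hX (hA j)
  obtain rfl : (fun j => T j * X * T j) = A := funext hTA
  have hc : Continuous fun Y : Matrix (Fin m) (Fin m) ℂ =>
      objective w (fun j => T j * X * T j) X + (Y.trace.re - X.trace.re) / 2
        - ((Y * ∑ j, w j • T j).trace.re - (X * ∑ j, w j • T j).trace.re) / 2 := by
    fun_prop
  have h := (hc.tendsto X).eventually_const_lt (u := y) (by simpa using hy)
  filter_upwards [nhdsWithin_le_nhds h, self_mem_nhdsWithin] with Y h1 hY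
  exact h1.trans_le (le_objective hw hw1 hX hT hY)

end Objective

/-! ### Compactness and existence of a balanced point -/

section Existence

/-- The positive definite matrices of bounded trace whose determinant is bounded below. -/
def traceDetSet (m : ℕ) (r δ : ℝ) : Set (Matrix (Fin m) (Fin m) ℂ) :=
  {X | X.PosDef ∧ X.trace.re ≤ r ∧ δ ≤ X.det.re}

lemma trace_conjTranspose_mul_self_re (P : Matrix (Fin m) (Fin m) ℂ) :
    (Pᴴ * P).trace.re = ∑ i, ∑ j, ‖P j i‖ ^ 2 := by
  simp only [trace, diag_apply, mul_apply, conjTranspose_apply, Complex.re_sum]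
  refine Finset.sum_congr rfl fun i _ => Finset.sum_congr rfl fun j _ => ?_
  rw [Complex.sq_norm, Complex.normSq_apply]
  simp

/-- The set is the image under P ↦ PᴴP of a closed set bounded by the trace; δ > 0 keeps it away
from the singular matrices. -/
lemma isCompact_traceDetSet {r δ : ℝ} (hδ : 0 < δ) : IsCompact (traceDetSet m r δ) := by
  have hK : IsCompact {P : Matrix (Fin m) (Fin m) ℂ |
      (Pᴴ * P).trace.re ≤ r ∧ δ ≤ (Pᴴ * P).det.re} := by
    -- The radius r + 1 avoids a square root: t² ≤ r gives 2t ≤ t² + 1 ≤ r + 1.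
    refine (isCompact_univ_pi fun _ : Fin m => isCompact_univ_pi fun _ : Fin m =>
      isCompact_closedBall (0 : ℂ) (r + 1)).of_isClosed_subset ?_ ?_
    · have h : Continuous fun P : Matrix (Fin m) (Fin m) ℂ => Pᴴ * P := by fun_prop
      exact (isClosed_le (Complex.continuous_re.comp h.matrix_trace) continuous_const).inter
        (isClosed_le continuous_const (Complex.continuous_re.comp h.matrix_det))
    · rintro (P : Matrix (Fin m) (Fin m) ℂ) ⟨h, -⟩ i - j -
      rw [trace_conjTranspose_mul_self_re] at h
      have h1 : ‖P i j‖ ^ 2 ≤ ∑ i, ‖P i j‖ ^ 2 :=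
        Finset.single_le_sum (f := fun i => ‖P i j‖ ^ 2) (fun _ _ => sq_nonneg _) (Finset.mem_univ i)
      have h2 : ∑ i, ‖P i j‖ ^ 2 ≤ ∑ j, ∑ i, ‖P i j‖ ^ 2 :=
        Finset.single_le_sum (f := fun j => ∑ i, ‖P i j‖ ^ 2)
          (fun _ _ => Finset.sum_nonneg fun _ _ => sq_nonneg _) (Finset.mem_univ j)
      rw [mem_closedBall_zero_iff]
      nlinarith [sq_nonneg (‖P i j‖ - 1)]
  have h : traceDetSet m r δ = (fun P => Pᴴ * P) '' {P : Matrix (Fin m) (Fin m) ℂ |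
      (Pᴴ * P).trace.re ≤ r ∧ δ ≤ (Pᴴ * P).det.re} := by
    ext X
    constructor
    · rintro ⟨hX, h⟩
      have e : (msqrt X)ᴴ * msqrt X = X := by
        rw [(posDef_msqrt hX).isHermitian.eq, msqrt_mul_self hX]
      exact ⟨msqrt X, by rwa [Set.mem_ofPred_eq, e], e⟩
    · rintro ⟨P, h, rfl⟩
      refine ⟨(posSemidef_conjTranspose_mul_self P).posDef_iff_det_ne_zero.2 fun h0 => ?_, h⟩
      have := h.2
      rw [h0, Complex.zero_re] at this
      linarith
  rw [h]
  exact hK.image (by fun_prop)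

lemma exists_balanced_transport {w : Fin n → ℝ} {A : Fin n → Matrix (Fin m) (Fin m) ℂ}
    (hw : ∀ j, 0 < w j) (hw1 : ∑ j, w j = 1) (hA : ∀ j, (A j).PosDef) :
    ∃ (X : Matrix (Fin m) (Fin m) ℂ) (T : Fin n → Matrix (Fin m) (Fin m) ℂ), X.PosDef ∧
      (∀ j, (T j).PosDef) ∧ ∑ j, w j • T j = 1 ∧ ∀ j, T j * X * T j = A j := by
  -- These bounds hold for SXS whatever the starting point X, so the fixed point map sends the whole
  -- cone into C.
  let C := traceDetSet m (∑ j, w j * (A j).trace.re) (∏ j, (A j).det.re ^ w j)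
  have step {X : Matrix (Fin m) (Fin m) ℂ} (hX : X.PosDef) :
      ∃ T : Fin n → Matrix (Fin m) (Fin m) ℂ, (∀ j, (T j).PosDef) ∧ (∀ j, T j * X * T j = A j) ∧
        (∑ j, w j • T j) * X * (∑ j, w j • T j) ∈ C := by
    choose T hT hTA using fun j => exists_transport hX (hA j)
    obtain rfl : (fun j => T j * X * T j) = A := funext hTA
    have hS := posDef_weightedSum hw hw1 hT
    refine ⟨T, hT, fun _ => rfl, posDef_congr hS hX, trace_congr_le hw hw1 hX hT hS rfl, ?_⟩
    rw [prod_det_congr hX hw1 hT, det_re_congr hS hX]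
    have h0 : 0 ≤ ∏ j, (T j).det.re ^ w j :=
      Finset.prod_nonneg fun j _ => (Real.rpow_pos_of_pos (det_re_pos (hT j)) _).le
    exact mul_le_mul_of_nonneg_right
      (pow_le_pow_left₀ h0 (prod_det_le_det_weightedSum hw hw1 hT) 2) (det_re_pos hX).le
  have hne : C.Nonempty := by
    obtain ⟨T, -, -, h⟩ := step PosDef.one
    exact ⟨_, h⟩
  obtain ⟨X, hXC, hmin⟩ := ((lowerSemicontinuousOn_objective hw hw1 hA).mono
    fun X (hX : X ∈ C) => hX.1).exists_isMinOn hne (isCompact_traceDetSet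
      (Finset.prod_pos fun j _ => Real.rpow_pos_of_pos (det_re_pos (hA j)) _))
  have hX := hXC.1
  obtain ⟨T, hT, hTA, hC⟩ := step hX
  refine ⟨X, T, hX, hT, ?_, hTA⟩
  obtain rfl : (fun j => T j * X * T j) = A := funext hTA
  have h1 := objective_congr_le hw hw1 hX hT (posDef_weightedSum hw hw1 hT) rfl
  have h2 : objective w (fun j => T j * X * T j) X ≤ objective w (fun j => T j * X * T j)
      ((∑ j, w j • T j) * X * ∑ j, w j • T j) := hmin hC
  -- Minimality over C contradicts the guaranteed decrease unless S = 1.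
  exact sub_eq_zero.1 (eq_zero_of_trace_weighted hX PosDef.one (by linarith))

end Existence

end WassersteinMean

/-- The determinant of a positive definite complex matrix is a positive real number; it is read
as a real number through its real part. The first two conjuncts say that the Wasserstein mean
really is the unique minimizer that its definition speaks of. -/
theorem theoremT (m n : ℕ) (A : Fin n → Matrix (Fin m) (Fin m) ℂ) (hA : ∀ j, (A j).PosDef)
    (w : Fin n → ℝ) (hw : ∀ j, 0 < w j) (hw1 : ∑ j, w j = 1) :
    WassersteinMean.IsMinimizer w A (WassersteinMean.mean w A) ∧
    (∀ X : Matrix (Fin m) (Fin m) ℂ,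
      WassersteinMean.IsMinimizer w A X → X = WassersteinMean.mean w A) ∧
    (∏ j, (A j).det.re ^ w j) ≤ (WassersteinMean.mean w A).det.re ∧
    ((WassersteinMean.mean w A).det.re = ∏ j, (A j).det.re ^ w j ↔ ∀ i j, A i = A j) := by
  obtain ⟨X, T, hX, hT, hS, hTA⟩ := WassersteinMean.exists_balanced_transport hw hw1 hA
  obtain rfl : (fun j => T j * X * T j) = A := funext hTA
  have hmin : WassersteinMean.IsMinimizer w (fun j => T j * X * T j) X := by
    refine ⟨hX, fun Y hY => ?_⟩
    have h := WassersteinMean.le_objective hw hw1 hX hT hY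
    -- With S = 1 the affine minorant is constant, so X is a global minimizer.
    rw [hS, mul_one, mul_one] at h
    rw [Set.mem_ofPred_eq]
    linarith
  have hmean : WassersteinMean.mean w (fun j => T j * X * T j) = X := by
    have h := Classical.epsilon_spec (p := WassersteinMean.IsMinimizer w _) ⟨X, hmin⟩
    exact WassersteinMean.eq_of_objective_le hw hw1 hX hT hS h.1 (h.2 hX)
  have hd := WassersteinMean.det_re_pos hX
  have hp0 : 0 ≤ ∏ j, (T j).det.re ^ w j := Finset.prod_nonneg fun j _ =>
    (Real.rpow_pos_of_pos (WassersteinMean.det_re_pos (hT j)) _).le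
  rw [hmean]
  refine ⟨hmin, fun Y hY => WassersteinMean.eq_of_objective_le hw hw1 hX hT hS hY.1 (hY.2 hX),
    ?_, ?_⟩
  · rw [WassersteinMean.prod_det_congr hX hw1 hT]
    exact mul_le_of_le_one_left hd.le
      (pow_le_one₀ hp0 (WassersteinMean.prod_det_le_one hw hw1 hT hS))
  · constructor
    · intro h
      rw [WassersteinMean.prod_det_congr hX hw1 hT, eq_comm, mul_eq_right₀ hd.ne',
        pow_eq_one_iff_of_nonneg hp0 two_ne_zero] at h
      have hT1 := WassersteinMean.eq_one_of_prod_det_eq_one hw hw1 hT hS h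
      simp [hT1]
    · intro h
      have hn : Nonempty (Fin n) := by
        by_contra hn
        rw [not_nonempty_iff] at hn
        simp at hw1
      obtain ⟨i⟩ := hn
      -- Equal targets have equal transports, and their average is 1, so each transport is 1.
      have hconst (j) : T j = T i :=
        WassersteinMean.transport_unique hX (hT j) (hT i) (h j i)
      have hTi : T i = 1 := by
        rw [← hS, Finset.sum_congr rfl fun j _ => by rw [hconst j], ← Finset.sum_smul, hw1, one_smul]
      simp [hconst, hTi, ← Real.rpow_sum_of_pos hd, hw1]
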